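/- Let $\mathbb K$ be $\mathbb R$ or $\mathbb C$ and let $\mathbf B$ be the category of Banach spaces over $\mathbb K$ and bounded linear operators. Let $\mathbf M$ be the category whose objects are the injective operators $f\colon X'\rightarrowtail X$ between Banach spaces, and whose morphisms from $f\colon X'\rightarrowtail X$ to $g\colon Y'\rightarrowtail Y$ are the commutative squares, that is, pairs of operators $u'\colon X'\to Y'$, $u\colon X\to Y$ with $gu'=uf$. Let $\mathbf{hM}$ have the same objects, with two morphisms $(u',u),(v',v)\colon f\to g$ of $\mathbf M$ identified when $u-v=gr$ for some operator $r\colon X\to Y'$. A pulation is a morphism of $\mathbf{hM}$ represented by a square that is both a pullback and a pushout in $\mathbf B$. The Waelbroeck–Wegner category $\mathbf W$ is the localization of $\mathbf{hM}$ at the class of pulations. Then the only injective object of $\mathbf W$, up to isomorphism, is the zero object: an object $A$ of $\mathbf W$ is injective (every morphism $C\to A$ extends along every monomorphism $C\to D$ of $\mathbf W$) if and only if $A$ is a zero object. Moreover, every nonzero object $A$ of $\mathbf W$ is the domain of a monomorphism $A\to B$ of $\mathbf W$ that has no left inverse. -/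

import Mathlib

open CategoryTheory

universe u

/-- A Banach space over `𝕜` (bundled). -/
structure Ban (𝕜 : Type) [RCLike 𝕜] : Type (u + 1) where
  of ::
  carrier : Type u
  [normedAddCommGroup : NormedAddCommGroup carrier]
  [normedSpace : NormedSpace 𝕜 carrier]
  [completeSpace : CompleteSpace carrier]

namespace Ban

variable {𝕜 : Type} [RCLike 𝕜]

attribute [instance] normedAddCommGroup normedSpace completeSpace

instance : CoeSort (Ban.{u} 𝕜) (Type u) := ⟨carrier⟩

/-- Morphisms of Banach spaces: the bounded linear operators. -/
@[ext]
structure Hom (X Y : Ban.{u} 𝕜) where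
  clm : X →L[𝕜] Y

/-- The category **B** of Banach spaces and bounded linear operators. -/
instance : Category (Ban.{u} 𝕜) where
  Hom X Y := Hom X Y
  id X := ⟨ContinuousLinearMap.id 𝕜 X⟩
  comp f g := ⟨g.clm.comp f.clm⟩

instance : ConcreteCategory (Ban.{u} 𝕜) (fun X Y => X →L[𝕜] Y) where
  hom f := f.clm
  ofHom f := ⟨f⟩

end Ban

/-- An object of the category **M**: an injective operator `map : X' ↣ X` between Banach spaces. -/
structure BanMono (𝕜 : Type) [RCLike 𝕜] : Type (u + 1) where
  src : Ban.{u} 𝕜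
  tgt : Ban.{u} 𝕜
  map : src ⟶ tgt
  injective : Function.Injective map

namespace BanMono

variable {𝕜 : Type} [RCLike 𝕜]

/-- A morphism of **M**: a commutative square of operators. -/
@[ext]
structure Hom (f g : BanMono.{u} 𝕜) where
  top : f.src ⟶ g.src
  bot : f.tgt ⟶ g.tgt
  comm : top ≫ g.map = f.map ≫ bot

/-- The category **M** of injective operators and commutative squares. -/
instance : Category (BanMono.{u} 𝕜) where
  Hom f g := Hom f g
  id f := ⟨𝟙 _, 𝟙 _, by simp⟩
  comp a b := ⟨a.top ≫ b.top, a.bot ≫ b.bot, by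
    rw [Category.assoc, b.comm, ← Category.assoc, a.comm, Category.assoc]⟩
  id_comp _ := Hom.ext (Category.id_comp _) (Category.id_comp _)
  comp_id _ := Hom.ext (Category.comp_id _) (Category.comp_id _)
  assoc _ _ _ := Hom.ext (Category.assoc _ _ _) (Category.assoc _ _ _)

/-- Two parallel morphisms `a, b : f ⟶ g` of **M**, where `f : X' ↣ X` and `g : Y' ↣ Y`, are
homotopic if their difference `X → Y` factors as `g ∘ r` for some operator `r : X → Y'`.
(The component `X' → Y'` of the difference is then `r ∘ f`, since `g` is injective.) -/
def homotopic (𝕜 : Type) [RCLike 𝕜] : HomRel (BanMono.{u} 𝕜) :=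
  fun f g a b => ∃ r : f.tgt ⟶ g.src, ∀ x : f.tgt, a.bot x - b.bot x = g.map (r x)

/-- Homotopy is a congruence on **M**, so that the quotient by it makes no further
identifications. -/
instance : Congruence (homotopic.{u} 𝕜) where
  equivalence {f g} :=
    { refl := fun _ => ⟨⟨0⟩, fun _ => (sub_self _).trans (map_zero g.map.clm).symm⟩
      symm := by
        rintro a b ⟨r, hr⟩
        refine ⟨⟨-r.clm⟩, fun x => ?_⟩
        rw [← neg_sub, hr x]
        exact (map_neg g.map.clm (r.clm x)).symm
      trans := by
        rintro a b c ⟨r, hr⟩ ⟨s, hs⟩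
        refine ⟨⟨r.clm + s.clm⟩, fun x => ?_⟩
        rw [← sub_add_sub_cancel _ (b.bot x), hr x, hs x]
        exact (map_add g.map.clm (r.clm x) (s.clm x)).symm }
  comp_left := by
    rintro f g h a b c ⟨r, hr⟩
    exact ⟨a.bot ≫ r, fun x => hr (a.bot.clm x)⟩
  comp_right := by
    rintro f g h a b c ⟨r, hr⟩
    refine ⟨r ≫ c.top, fun x => ?_⟩
    have h1 : c.bot.clm (a.bot.clm x) - c.bot.clm (b.bot.clm x)
        = c.bot.clm (g.map.clm (r.clm x)) := by
      rw [← map_sub]; exact congrArg c.bot.clm (hr x)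
    exact h1.trans (congrArg (fun k : g.src ⟶ h.tgt => k.clm (r.clm x)) c.comm).symm

/-- A morphism of **M** is a pulation square if it is both a pullback and a pushout in **B**. -/
def IsPulation {f g : BanMono.{u} 𝕜} (a : f ⟶ g) : Prop :=
  BicartesianSq a.top f.map g.map a.bot

end BanMono

/-- The category **hM**: the objects of **M**, and morphisms of **M** modulo homotopy. -/
abbrev HBanMono (𝕜 : Type) [RCLike 𝕜] : Type (u + 1) :=
  CategoryTheory.Quotient (BanMono.homotopic.{u} 𝕜)

/-- The pulations: the morphisms of **hM** that are represented by a pulation square. -/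
def pulations (𝕜 : Type) [RCLike 𝕜] : MorphismProperty (HBanMono.{u} 𝕜) :=
  fun f g φ => ∃ a : f.as ⟶ g.as,
    BanMono.IsPulation a ∧ (CategoryTheory.Quotient.functor (BanMono.homotopic 𝕜)).map a = φ

/-- The Waelbroeck–Wegner category **W**: the localization of **hM** at the pulations. -/
abbrev WCat (𝕜 : Type) [RCLike 𝕜] : Type (u + 1) :=
  (pulations.{u} 𝕜).Localization

/-! An object `f : X' ↣ X` stands for the quotient `X / X'`, and it is zero once `f` is onto. If `f`
is not onto, Baire's theorem gives a point `x` at positive distance `δ n` from the `f`-image of each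
ball of radius `n`. Choose positive summable weights `c` with tails very small compared with `δ`,
let `D` be multiplication by `c` on `ℓ¹`, and let `y₀ = c`, which is not in the range of `D`. Glue
`X / X'` to `ℓ¹ / D ℓ¹` by identifying `x` with `y₀`; the inclusion of `X / X'` is a monomorphism. A
retraction would yield operators `T : ℓ¹ → X` and `T' : ℓ¹ → X'` with `T D = f T'` and `T y₀ = x`
modulo `f X'`. But `T y₀` is the sum of the `c n • T eₙ = f (T' eₙ)`: its partial sums are images of
vectors of norm at most linear in `N`, and its tails are too small to bridge the distance to `x`
(`exists_weights_apply_ne`). Two facts make **W** tractable: morphisms out of an object with target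
`ℓ¹` come from **M**, because `ℓ¹` is projective (`exists_map_eq`), and `X / X'` is a faithful
functor from **W** to vector spaces. -/

/-- The Banach space of absolutely summable families of scalars indexed by `ι`. -/
abbrev EllOne (𝕜 : Type) [RCLike 𝕜] (ι : Type u) : Type u := lp (fun _ : ι => 𝕜) 1

/-! ### Projectivity of `ℓ¹` spaces -/

namespace EllOne

variable {𝕜 : Type} [RCLike 𝕜] {ι : Type u}

open Classical in
variable (𝕜) in
/-- The unit vectors of `ℓ¹`. -/
noncomputable def unit (i : ι) : EllOne 𝕜 ι := lp.single 1 i (1 : 𝕜)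

@[simp]
theorem unit_apply_self (i : ι) : unit 𝕜 i i = 1 := by simp [unit]

theorem unit_apply_of_ne {i j : ι} (h : j ≠ i) : unit 𝕜 i j = 0 := by
  simp [unit, h]

@[simp]
theorem norm_unit (i : ι) : ‖unit 𝕜 i‖ = 1 := by simp [unit, lp.norm_single]

theorem summable_norm (a : EllOne 𝕜 ι) : Summable fun i => ‖a i‖ := by
  simpa using (lp.hasSum_norm (p := 1) (by simp) a).summable

theorem norm_eq_tsum (a : EllOne 𝕜 ι) : ‖a‖ = ∑' i, ‖a i‖ := by
  simpa using (lp.hasSum_norm (p := 1) (by simp) a).tsum_eq.symm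

variable {E F : Type*} [NormedAddCommGroup E] [NormedSpace 𝕜 E]
  [NormedAddCommGroup F] [NormedSpace 𝕜 F]

theorem hasSum_apply (T : EllOne 𝕜 ι →L[𝕜] E) (a : EllOne 𝕜 ι) :
    HasSum (fun i => a i • T (unit 𝕜 i)) (T a) := by
  classical
  convert T.hasSum (lp.hasSum_single (by simp) a) using 1
  funext i
  rw [← map_smul, unit, ← lp.single_smul, smul_eq_mul, mul_one]

theorem ext_single {S T : EllOne 𝕜 ι →L[𝕜] E}
    (h : ∀ i, S (unit 𝕜 i) = T (unit 𝕜 i)) : S = T := by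
  ext a
  refine (hasSum_apply S a).unique ?_
  simpa only [h] using hasSum_apply T a

/-- A bounded family of vectors in a Banach space extends to an operator on `ℓ¹`. -/
theorem exists_extend [CompleteSpace E] (z : ι → E) {C : ℝ} (hz : ∀ i, ‖z i‖ ≤ C) :
    ∃ T : EllOne 𝕜 ι →L[𝕜] E, ∀ a, HasSum (fun i => a i • z i) (T a) := by
  have hle (a : EllOne 𝕜 ι) (i : ι) : ‖a i • z i‖ ≤ C * ‖a i‖ := by
    rw [norm_smul, mul_comm]
    exact mul_le_mul_of_nonneg_right (hz i) (norm_nonneg _)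
  have hn (a : EllOne 𝕜 ι) : Summable fun i => ‖a i • z i‖ :=
    .of_nonneg_of_le (fun _ => norm_nonneg _) (hle a) ((summable_norm a).mul_left C)
  have hs (a : EllOne 𝕜 ι) : Summable fun i => a i • z i := (hn a).of_norm
  refine ⟨LinearMap.mkContinuous
    { toFun := fun a => ∑' i, a i • z i
      map_add' := fun a b => ?_
      map_smul' := fun r a => ?_ } C fun a => ?_, fun a => (hs a).hasSum⟩
  · rw [← (hs a).tsum_add (hs b)]
    exact tsum_congr fun i => add_smul _ _ _
  · rw [RingHom.id_apply, ← (hs a).tsum_const_smul]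
    exact tsum_congr fun i => mul_smul r (a i) (z i)
  · calc ‖∑' i, a i • z i‖ ≤ ∑' i, ‖a i • z i‖ := norm_tsum_le_tsum_norm (hn a)
      _ ≤ ∑' i, C * ‖a i‖ := (hn a).tsum_le_tsum (hle a) ((summable_norm a).mul_left C)
      _ = C * ‖a‖ := by rw [tsum_mul_left, norm_eq_tsum]

theorem exists_extend_single [CompleteSpace E] (z : ι → E) {C : ℝ} (hz : ∀ i, ‖z i‖ ≤ C) :
    ∃ T : EllOne 𝕜 ι →L[𝕜] E, ∀ i, T (unit 𝕜 i) = z i := by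
  classical
  obtain ⟨T, hT⟩ := exists_extend (𝕜 := 𝕜) z hz
  refine ⟨T, fun i => (hT _).unique ?_⟩
  convert hasSum_ite_eq i (z i) using 2 with j
  by_cases h : j = i
  · subst h
    simp
  · simp [h, unit_apply_of_ne]

/-- `ℓ¹` is projective with respect to surjective operators. -/
theorem exists_lift [CompleteSpace E] [CompleteSpace F] (q : E →L[𝕜] F)
    (hq : Function.Surjective q) (T : EllOne 𝕜 ι →L[𝕜] F) :
    ∃ S : EllOne 𝕜 ι →L[𝕜] E, ∀ a, q (S a) = T a := by
  obtain ⟨C, hC, h⟩ := q.exists_preimage_norm_le hq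
  choose g hg hgn using h
  obtain ⟨S, hS⟩ := exists_extend_single (𝕜 := 𝕜) (ι := ι)
    (fun i => g (T (unit 𝕜 i))) (C := C * ‖T‖) fun i => by
      refine (hgn _).trans (mul_le_mul_of_nonneg_left ?_ hC.le)
      exact (T.le_opNorm _).trans_eq (by simp)
  have : q.comp S = T := ext_single fun i => by simp [hS, hg]
  exact ⟨S, fun a => congrArg (fun k => k a) this⟩

/-- Every Banach space is a quotient of an `ℓ¹` space. -/
theorem exists_surjective (E : Type u) [NormedAddCommGroup E] [NormedSpace 𝕜 E] [CompleteSpace E] :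
    ∃ T : EllOne 𝕜 E →L[𝕜] E, Function.Surjective T := by
  -- Unit vectors go to normalized vectors; at `x = 0` the convention `0⁻¹ = 0` gives the value `0`.
  obtain ⟨T, hT⟩ := exists_extend_single (𝕜 := 𝕜) (fun x : E => ((‖x‖⁻¹ : ℝ) : 𝕜) • x) (C := 1)
    fun x => by
      rw [norm_smul]
      simpa using inv_mul_le_one
  refine ⟨T, fun x => ⟨((‖x‖ : ℝ) : 𝕜) • unit 𝕜 x, ?_⟩⟩
  rw [map_smul, hT, smul_smul, ← RCLike.ofReal_mul]
  by_cases h : x = 0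
  · simp [h]
  · rw [mul_inv_cancel₀ (norm_ne_zero_iff.2 h)]
    simp

end EllOne

/-! ### Closed graph, open mapping and Baire category -/

namespace ContinuousLinearMap

variable {𝕜 : Type*} [RCLike 𝕜] {E F G : Type*}
  [NormedAddCommGroup E] [NormedSpace 𝕜 E] [CompleteSpace E]
  [NormedAddCommGroup F] [NormedSpace 𝕜 F]
  [NormedAddCommGroup G] [NormedSpace 𝕜 G]

/-- An operator whose values lie in the range of an injective operator `g` factors through `g`. -/
theorem exists_factor_of_injective [CompleteSpace F] (g : F →L[𝕜] G) (hg : Function.Injective g) (T : E →L[𝕜] G)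
    (h : ∀ x, ∃ y, g y = T x) : ∃ r : E →L[𝕜] F, ∀ x, g (r x) = T x := by
  choose r hr using h
  let R : E →ₗ[𝕜] F :=
    { toFun := r
      map_add' := fun x y => hg (by simp [hr])
      map_smul' := fun c x => hg (by simp [hr]) }
  refine ⟨ofSeqClosedGraph (g := R) fun v x y hv hy => hg ?_, fun x => hr x⟩
  have h1 := (g.continuous.tendsto y).comp hy
  have h2 := (T.continuous.tendsto x).comp hv
  have h3 : (g ∘ R ∘ v) = T ∘ v := funext fun n => hr (v n)
  rw [h3] at h1
  exact (tendsto_nhds_unique h1 h2).trans (hr x).symm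

/-- An operator that vanishes on the kernel of a surjective operator `q` factors through `q`. -/
theorem exists_factor_of_surjective [CompleteSpace F] (q : E →L[𝕜] F) (hq : Function.Surjective q) (T : E →L[𝕜] G)
    (h : ∀ x, q x = 0 → T x = 0) : ∃ r : F →L[𝕜] G, ∀ x, r (q x) = T x := by
  choose s hs using hq
  have key (x : E) : T (s (q x)) = T x := by
    rw [← sub_eq_zero, ← map_sub]
    exact h _ (by simp [hs])
  let R : F →ₗ[𝕜] G :=
    { toFun := fun y => T (s y)
      map_add' := fun x y => by
        rw [← map_add, ← key (s x + s y), map_add, hs, hs]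
      map_smul' := fun c x => by
        rw [RingHom.id_apply, ← map_smul, ← key (c • s x), map_smul, hs] }
  have hR : Continuous R := by
    rw [(q.isQuotientMap fun y => ⟨s y, hs y⟩).continuous_iff]
    have : R ∘ q = T := funext key
    rw [this]
    exact T.continuous
  exact ⟨⟨R, hR⟩, key⟩

/-- If approximate preimages with controlled norm exist, then so do exact ones. -/
theorem surjective_of_approx_preimage (f : E →L[𝕜] F) {C : ℝ}
    (h : ∀ y, ∃ x, ‖f x - y‖ ≤ 1 / 2 * ‖y‖ ∧ ‖x‖ ≤ C * ‖y‖) : Function.Surjective f := by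
  choose g hg hgn using h
  intro y
  let e (y : F) : F := y - f (g y)
  have he (n : ℕ) : ‖e^[n] y‖ ≤ (1 / 2) ^ n * ‖y‖ := by
    induction n with
    | zero => simp
    | succ n ih =>
      rw [Function.iterate_succ_apply', pow_succ', mul_assoc]
      refine le_trans ?_ (mul_le_mul_of_nonneg_left ih (by norm_num))
      rw [norm_sub_rev]
      exact hg _
  -- Successive correction: `e^[n] y` is the error left after `n` steps, and `v n` is its
  -- approximate preimage.
  let v (n : ℕ) : E := g (e^[n] y)
  have hv (n : ℕ) : ‖v n‖ ≤ (1 / 2) ^ n * (|C| * ‖y‖) := by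
    refine (hgn _).trans ?_
    calc C * ‖e^[n] y‖ ≤ |C| * ((1 / 2) ^ n * ‖y‖) := by
          gcongr
          · exact le_abs_self C
          · exact he n
      _ = _ := by ring
  have hs : Summable v := .of_norm_bounded (summable_geometric_two.mul_right _) hv
  have hsum (n : ℕ) : f (∑ i ∈ Finset.range n, v i) = y - e^[n] y := by
    induction n with
    | zero => simp
    | succ n ih => rw [Finset.sum_range_succ, map_add, ih, Function.iterate_succ_apply', sub_add]
  refine ⟨tsum v, tendsto_nhds_unique ((f.continuous.tendsto _).comp hs.hasSum.tendsto_sum_nat) ?_⟩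
  have h0 : Filter.Tendsto (fun n => e^[n] y) Filter.atTop (nhds 0) := by
    refine squeeze_zero_norm he ?_
    rw [← zero_mul ‖y‖]
    exact (tendsto_pow_atTop_nhds_zero_of_lt_one (by norm_num) (by norm_num)).mul_const _
  simpa [Function.comp_def, hsum] using tendsto_const_nhds.sub h0

/-- If every point is a limit of images of some bounded set, then the operator is surjective. -/
theorem surjective_of_mem_closure_image_ball [CompleteSpace F] (f : E →L[𝕜] F)
    (h : ∀ y, ∃ n : ℕ, y ∈ closure (f '' Metric.closedBall 0 n)) : Function.Surjective f := by
  obtain ⟨n, a, ha⟩ := nonempty_interior_of_iUnion_of_closed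
    (f := fun n : ℕ => closure (f '' Metric.closedBall 0 n)) (fun n => isClosed_closure)
    (Set.eq_univ_of_forall fun y => Set.mem_iUnion.2 (h y))
  rw [mem_interior_iff_mem_nhds, Metric.mem_nhds_iff] at ha
  obtain ⟨ε, hε, H⟩ := ha
  refine f.surjective_of_approx_preimage (C := 2 * ε⁻¹ * (n + n)) fun y => ?_
  rcases eq_or_ne y 0 with rfl | hy
  · exact ⟨0, by simp⟩
  have hy' : 0 < ‖y‖ := norm_pos_iff.2 hy
  -- Then `d • y` has norm `ε / 2`, so `a + d • y` stays in the ball. Dividing the two errors `ε /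
  -- 8` by `d` leaves exactly `‖y‖ / 2`.
  set d : ℝ := ε / (2 * ‖y‖) with hd
  have hdpos : 0 < d := by positivity
  have hdn : ‖(d : 𝕜)‖ = d := by simp [abs_of_pos hdpos]
  have approx (b : F) (hb : b ∈ Metric.ball a ε) :
      ∃ x, ‖x‖ ≤ n ∧ ‖f x - b‖ ≤ ε / 8 := by
    obtain ⟨_, ⟨x, hx, rfl⟩, hxb⟩ := Metric.mem_closure_iff.1 (H hb) (ε / 8) (by positivity)
    exact ⟨x, by simpa using hx, by rw [← dist_eq_norm, dist_comm]; exact hxb.le⟩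
  obtain ⟨x₁, hx₁, h₁⟩ := approx (a + (d : 𝕜) • y) (by
    rw [mem_ball_iff_norm, add_sub_cancel_left, norm_smul, hdn, hd]
    field_simp
    norm_num)
  obtain ⟨x₂, hx₂, h₂⟩ := approx a (by simpa using hε)
  have hd0 : (d : 𝕜) ≠ 0 := by exact_mod_cast hdpos.ne'
  have hinv : ‖(d : 𝕜)⁻¹‖ = 2 * ε⁻¹ * ‖y‖ := by
    rw [norm_inv, hdn, hd]
    field_simp
  refine ⟨(d : 𝕜)⁻¹ • (x₁ - x₂), ?_, ?_⟩
  · have : f ((d : 𝕜)⁻¹ • (x₁ - x₂)) - y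
        = (d : 𝕜)⁻¹ • ((f x₁ - (a + (d : 𝕜) • y)) - (f x₂ - a)) := by
      rw [map_smul, map_sub, eq_inv_smul_iff₀ hd0, smul_sub, smul_inv_smul₀ hd0]
      abel
    rw [this, norm_smul, hinv]
    calc 2 * ε⁻¹ * ‖y‖ * _ ≤ 2 * ε⁻¹ * ‖y‖ * (ε / 8 + ε / 8) := by
          gcongr
          exact (norm_sub_le _ _).trans (add_le_add h₁ h₂)
      _ = 1 / 2 * ‖y‖ := by field_simp; norm_num
  · rw [norm_smul, hinv]
    calc 2 * ε⁻¹ * ‖y‖ * ‖x₁ - x₂‖ ≤ 2 * ε⁻¹ * ‖y‖ * (n + n) := by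
          gcongr
          exact (norm_sub_le _ _).trans (add_le_add hx₁ hx₂)
      _ = _ := by ring

/-- For a non-surjective operator, some point has positive distance from the image of each ball. -/
theorem exists_dist_image_ball [CompleteSpace F] (f : E →L[𝕜] F) (hf : ¬ Function.Surjective f) :
    ∃ y, ∀ n : ℕ, ∃ δ > 0, ∀ x, ‖x‖ ≤ n → δ ≤ ‖y - f x‖ := by
  contrapose! hf
  refine f.surjective_of_mem_closure_image_ball fun y => ?_
  obtain ⟨n, hn⟩ := hf y
  refine ⟨n, Metric.mem_closure_iff.2 fun δ hδ => ?_⟩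
  obtain ⟨x, hx, hxy⟩ := hn δ hδ
  exact ⟨f x, ⟨x, by simpa using hx, rfl⟩, by rwa [dist_eq_norm]⟩

end ContinuousLinearMap

/-! ### The analytic obstruction to a retraction -/

/-- A sequence of positive weights whose tails are dominated by a given positive sequence. -/
theorem exists_weights_tail_le (ε : ℕ → ℝ) (hε : ∀ n, 0 < ε n) :
    ∃ c : ℕ → ℝ, (∀ n, 0 < c n) ∧ (∀ n, c n ≤ 1) ∧ Summable c ∧
      ∀ N, ∑' n, c (n + N) ≤ ε N := by
  -- The product up to and including `n` makes every `p (n + N)` contain the factor `min 1 (ε N)`; a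
  -- geometric factor then provides summability.
  set p : ℕ → ℝ := fun n => ∏ k ∈ Finset.range (n + 1), min 1 (ε k) with hp
  have hp0 (n) : 0 < p n := Finset.prod_pos fun k _ => lt_min one_pos (hε k)
  have hp1 (n) : p n ≤ 1 :=
    Finset.prod_le_one (fun k _ => (lt_min one_pos (hε k)).le) fun k _ => min_le_left _ _
  have hpε (n N) : p (n + N) ≤ ε N := by
    have hN : N ∈ Finset.range (n + N + 1) := by simp
    rw [hp]
    dsimp only
    rw [← Finset.mul_prod_erase _ _ hN]
    refine (mul_le_of_le_one_right (lt_min one_pos (hε N)).le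
      (Finset.prod_le_one (fun k _ => (lt_min one_pos (hε k)).le) fun k _ => min_le_left _ _)).trans
      (min_le_right _ _)
  have hg : Summable fun n : ℕ => (1 / 2 : ℝ) / 2 * (1 / 2) ^ n := summable_geometric_two.mul_left _
  have hle (n N) : (1 / 2 : ℝ) / 2 * (1 / 2) ^ (n + N) ≤ 1 / 2 / 2 * (1 / 2) ^ n := by
    gcongr ?_ * ?_
    exact pow_le_pow_of_le_one (by norm_num) (by norm_num) (Nat.le_add_right _ _)
  have hb (n N) : (1 / 2 : ℝ) / 2 * (1 / 2) ^ (n + N) * p (n + N)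
      ≤ 1 / 2 / 2 * (1 / 2) ^ n * ε N :=
    mul_le_mul (hle n N) (hpε n N) (hp0 _).le (by positivity)
  have hs : Summable fun n : ℕ => (1 / 2 : ℝ) / 2 * (1 / 2) ^ n * p n :=
    .of_nonneg_of_le (fun n => mul_nonneg (by positivity) (hp0 n).le)
      (fun n => mul_le_of_le_one_right (by positivity) (hp1 n)) hg
  refine ⟨fun n => 1 / 2 / 2 * (1 / 2) ^ n * p n, fun n => mul_pos (by positivity) (hp0 n),
    fun n => ?_, hs, fun N => ?_⟩
  · refine mul_le_one₀ (mul_le_one₀ (by norm_num) (by positivity) ?_) (hp0 n).le (hp1 n)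
    exact pow_le_one₀ (by norm_num) (by norm_num)
  · calc ∑' n, 1 / 2 / 2 * (1 / 2) ^ (n + N) * p (n + N)
        ≤ ∑' n, 1 / 2 / 2 * (1 / 2) ^ n * ε N :=
          ((summable_nat_add_iff N).2 hs).tsum_le_tsum (fun n => hb n N) (hg.mul_right _)
      _ = 1 / 2 * ε N := by rw [tsum_mul_right, tsum_mul_left, tsum_geometric_two]; ring
      _ ≤ ε N := by linarith [hε N]

/-- For a non-surjective operator `f : X' → X` there are a point `x : X` and weights `c` such that
no operator `T : ℓ¹ → X` that carries the weighted `ℓ¹` space with weights `c` into `X'` maps the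
sequence `c` to `x` modulo the range of `f`. -/
theorem ContinuousLinearMap.exists_weights_apply_ne {𝕜 : Type} [RCLike 𝕜] {E F : Type*}
    [NormedAddCommGroup E] [NormedSpace 𝕜 E] [CompleteSpace E]
    [NormedAddCommGroup F] [NormedSpace 𝕜 F] [CompleteSpace F]
    (f : E →L[𝕜] F) (hf : ¬ Function.Surjective f) :
    ∃ (x : F) (c : ℕ → ℝ), (∀ n, 0 < c n) ∧ (∀ n, c n ≤ 1) ∧ Summable c ∧
      ∀ (T : EllOne 𝕜 (ULift.{u} ℕ) →L[𝕜] F) (T' : EllOne 𝕜 (ULift.{u} ℕ) →L[𝕜] E),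
        (∀ i, (c i.down : 𝕜) • T (EllOne.unit 𝕜 i) = f (T' (EllOne.unit 𝕜 i))) →
        ∀ a : EllOne 𝕜 (ULift.{u} ℕ), (∀ i, a i = c i.down) → ∀ z, T a ≠ x + f z := by
  obtain ⟨x, hx⟩ := f.exists_dist_image_ball hf
  choose δ hδ0 hδ using hx
  -- The weights must precede `T`, `T'` and `z`. For large `N`, the index `N * N` absorbs the bound
  -- `N * ‖T'‖ + ‖z‖` on the preimage, and the divisor `N + 1` absorbs `‖T‖`.
  obtain ⟨c, hc0, hc1, hcs, hc⟩ := exists_weights_tail_le (fun N => δ (N * N) / (N + 1))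
    fun N => div_pos (hδ0 _) (by positivity)
  refine ⟨x, c, hc0, hc1, hcs, fun T T' hTT' a ha z hz => ?_⟩
  obtain ⟨N, hN⟩ := exists_nat_ge (max 1 (max ‖T‖ (‖T'‖ + ‖z‖)))
  simp only [max_le_iff] at hN
  obtain ⟨hN1, hNT, hNT'⟩ := hN
  set w : ℕ → F := fun n => (c n : 𝕜) • T (EllOne.unit 𝕜 ⟨n⟩) with hw
  have hsum : HasSum w (T a) := by
    have := EllOne.hasSum_apply T a
    rw [← Equiv.ulift.symm.hasSum_iff] at this
    simpa [Function.comp_def, ha] using this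
  have hwn (n : ℕ) : ‖w n‖ ≤ ‖T‖ * c n := by
    rw [hw, norm_smul, mul_comm]
    refine mul_le_mul ?_ (by simp [abs_of_pos (hc0 n)]) (norm_nonneg _) (norm_nonneg _)
    exact (T.le_opNorm _).trans_eq (by simp)
  have htail : ‖∑' n, w (n + N)‖ ≤ ‖T‖ * (δ (N * N) / (N + 1)) := by
    have hs := ((summable_nat_add_iff N).2 hcs).mul_left ‖T‖
    calc ‖∑' n, w (n + N)‖ ≤ ∑' n, ‖T‖ * c (n + N) :=
          tsum_of_norm_bounded hs.hasSum fun n => hwn (n + N)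
      _ ≤ _ := by
          rw [tsum_mul_left]
          exact mul_le_mul_of_nonneg_left (hc N) (norm_nonneg _)
  set s : E := ∑ n ∈ Finset.range N, T' (EllOne.unit 𝕜 ⟨n⟩) - z with hs
  have hsn : ‖s‖ ≤ (N * N : ℕ) := by
    have h1 : ‖∑ n ∈ Finset.range N, T' (EllOne.unit 𝕜 (ULift.up.{u} n))‖ ≤ N * ‖T'‖ := by
      refine (norm_sum_le_of_le _ (f := fun n => T' (EllOne.unit 𝕜 (ULift.up.{u} n)))
        (n := fun _ => ‖T'‖) fun n _ => (T'.le_opNorm _).trans_eq (by simp)).trans_eq (by simp)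
    have h2 := norm_sub_le (∑ n ∈ Finset.range N, T' (EllOne.unit 𝕜 (ULift.up.{u} n))) z
    push_cast
    nlinarith [norm_nonneg z, norm_nonneg T']
  have hx : x - f s = ∑' n, w (n + N) := by
    have h1 := hsum.summable.sum_add_tsum_nat_add N
    rw [hsum.tsum_eq, hz] at h1
    have h2 : f s = ∑ n ∈ Finset.range N, w n - f z := by
      rw [hs, map_sub, map_sum]
      exact congrArg (· - f z) (Finset.sum_congr rfl fun n _ => (hTT' ⟨n⟩).symm)
    rw [h2, sub_sub_eq_add_sub, ← h1, add_sub_cancel_left]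
  have h3 := (hδ _ s hsn).trans (hx ▸ htail)
  rw [← mul_div_assoc, le_div_iff₀ (by positivity)] at h3
  nlinarith [hδ0 (N * N)]

/-! ### Pulations and lifting along them -/

namespace BanMono

variable {𝕜 : Type} [RCLike 𝕜]

theorem Hom.comm_apply {f g : BanMono.{u} 𝕜} (a : f ⟶ g) (x : f.src) :
    g.map.clm (a.top.clm x) = a.bot.clm (f.map.clm x) :=
  congrArg (fun k : f.src ⟶ g.tgt => k.clm x) a.comm

/-- An operator that preserves the ranges extends to a commutative square. -/
theorem exists_hom_bot_eq (f g : BanMono.{u} 𝕜) (T : f.tgt →L[𝕜] g.tgt)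
    (h : ∀ x : f.src, ∃ y : g.src, g.map.clm y = T (f.map.clm x)) :
    ∃ a : f ⟶ g, a.bot.clm = T := by
  obtain ⟨r, hr⟩ := g.map.clm.exists_factor_of_injective g.injective (T.comp f.map.clm) h
  exact ⟨⟨⟨r⟩, ⟨T⟩, Ban.Hom.ext (ContinuousLinearMap.ext hr)⟩, rfl⟩

/-- By the closed graph theorem, a pointwise choice of preimages under `g` is automatically a
bounded operator. -/
theorem homotopic_of_forall_exists {f g : BanMono.{u} 𝕜} {a b : f ⟶ g}
    (h : ∀ x : f.tgt, ∃ y : g.src, g.map.clm y = a.bot.clm x - b.bot.clm x) :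
    homotopic 𝕜 a b := by
  obtain ⟨r, hr⟩ := g.map.clm.exists_factor_of_injective g.injective (a.bot.clm - b.bot.clm) h
  exact ⟨⟨r⟩, fun x => (hr x).symm⟩

/-- The pairs with equal image form a closed subspace of the product, hence a Banach space against
which the universal property of the pullback can be tested. -/
theorem IsPulation.exists_src {f g : BanMono.{u} 𝕜} {a : f ⟶ g} (ha : IsPulation a)
    {x : f.tgt} {y : g.src} (h : a.bot.clm x = g.map.clm y) : ∃ x' : f.src, f.map.clm x' = x := by
  let d : (g.src × f.tgt) →L[𝕜] g.tgt :=
    g.map.clm.comp (.fst 𝕜 _ _) - a.bot.clm.comp (.snd 𝕜 _ _)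
  let K : Submodule 𝕜 (g.src × f.tgt) := d.ker
  have : CompleteSpace K := (ContinuousLinearMap.isClosed_ker d).completeSpace_coe
  let p : Ban.of (𝕜 := 𝕜) K ⟶ g.src := ⟨(ContinuousLinearMap.fst 𝕜 _ _).comp K.subtypeL⟩
  let q : Ban.of (𝕜 := 𝕜) K ⟶ f.tgt := ⟨(ContinuousLinearMap.snd 𝕜 _ _).comp K.subtypeL⟩
  have hpq : p ≫ g.map = q ≫ a.bot :=
    Ban.Hom.ext (ContinuousLinearMap.ext fun k => sub_eq_zero.1 k.2)
  let k : K := ⟨(y, x), sub_eq_zero.2 h.symm⟩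
  exact ⟨(ha.toIsPullback.lift p q hpq).clm k,
    congrArg (fun r : Ban.of (𝕜 := 𝕜) K ⟶ f.tgt => r.clm k) (ha.toIsPullback.lift_snd p q hpq)⟩

/-- Divide `Y' × X` by the kernel of the sum operator into `Y`. The quotient is a cocone, and the
map it receives from the pushout is a section of the induced operator to `Y`, so the sum operator is
onto. -/
theorem IsPulation.exists_add {f g : BanMono.{u} 𝕜} {a : f ⟶ g} (ha : IsPulation a)
    (y : g.tgt) : ∃ (x : f.tgt) (y' : g.src), a.bot.clm x + g.map.clm y' = y := by
  let d : (g.src × f.tgt) →L[𝕜] g.tgt :=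
    g.map.clm.comp (.fst 𝕜 _ _) + a.bot.clm.comp (.snd 𝕜 _ _)
  let K : Submodule 𝕜 (g.src × f.tgt) := d.ker
  have : IsClosed (K : Set (g.src × f.tgt)) := ContinuousLinearMap.isClosed_ker d
  let Z : Ban.{u} 𝕜 := Ban.of (𝕜 := 𝕜) ((g.src × f.tgt) ⧸ K)
  let p : g.src ⟶ Z := ⟨K.mkQL.comp (.inl 𝕜 _ _)⟩
  let q : f.tgt ⟶ Z := ⟨K.mkQL.comp (.inr 𝕜 _ _)⟩
  have hpq : a.top ≫ p = f.map ≫ q := by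
    refine Ban.Hom.ext (ContinuousLinearMap.ext fun x => ?_)
    refine (Submodule.Quotient.eq K).2 ?_
    change d _ = 0
    simp [d, Hom.comm_apply]
  let e : Z ⟶ g.tgt := ⟨K.liftQL d le_rfl⟩
  have he : ha.toIsPushout.desc p q hpq ≫ e = 𝟙 _ := by
    apply ha.toIsPushout.hom_ext
    · rw [← Category.assoc, ha.toIsPushout.inl_desc]
      refine Ban.Hom.ext (ContinuousLinearMap.ext fun x => ?_)
      change d (x, 0) = g.map.clm x
      simp [d]
    · rw [← Category.assoc, ha.toIsPushout.inr_desc]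
      refine Ban.Hom.ext (ContinuousLinearMap.ext fun x => ?_)
      change d (0, x) = a.bot.clm x
      simp [d]
  obtain ⟨⟨y', x⟩, h⟩ := K.mkQ_surjective ((ha.toIsPushout.desc p q hpq).clm y)
  refine ⟨x, y', ?_⟩
  have h1 : e.clm ((ha.toIsPushout.desc p q hpq).clm y) = y :=
    congrArg (fun r : g.tgt ⟶ g.tgt => r.clm y) he
  rw [← h] at h1
  change d (y', x) = y at h1
  rw [← h1]
  simp [d, add_comm]

/-- A square whose operator on targets is surjective and which is a pullback of vector spaces is a
pulation. -/
theorem isPulation_of_surjective {f g : BanMono.{u} 𝕜} (a : f ⟶ g)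
    (ha : Function.Surjective a.bot.clm)
    (h : ∀ (x : f.tgt) (y : g.src), a.bot.clm x = g.map.clm y → ∃ x' : f.src, f.map.clm x' = x) :
    IsPulation a := by
  have hlift (s : Limits.PullbackCone g.map a.bot) : ∃ r : s.pt ⟶ f.src, r ≫ f.map = s.snd := by
    obtain ⟨r, hr⟩ := f.map.clm.exists_factor_of_injective f.injective s.snd.clm fun x =>
      h _ (s.fst.clm x) (congrArg (fun k : s.pt ⟶ g.tgt => k.clm x) s.condition).symm
    exact ⟨⟨r⟩, Ban.Hom.ext (ContinuousLinearMap.ext hr)⟩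
  have hdesc (s : Limits.PushoutCocone a.top f.map) : ∃ r : g.tgt ⟶ s.pt, a.bot ≫ r = s.inr := by
    obtain ⟨r, hr⟩ := a.bot.clm.exists_factor_of_surjective ha s.inr.clm fun x hx => by
      obtain ⟨x', rfl⟩ := h x 0 (by rw [hx, map_zero])
      rw [← Hom.comm_apply, ← map_zero g.map.clm] at hx
      have h1 : s.inl.clm (a.top.clm x') = s.inr.clm (f.map.clm x') :=
        congrArg (fun k : f.src ⟶ s.pt => k.clm x') s.condition
      have h2 : a.top.clm x' = 0 := g.injective hx
      rw [← h1, h2, map_zero]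
    exact ⟨⟨r⟩, Ban.Hom.ext (ContinuousLinearMap.ext hr)⟩
  have hmono {Z : Ban.{u} 𝕜} (k : BanMono.{u} 𝕜) (r r' : Z ⟶ k.src) (e : r ≫ k.map = r' ≫ k.map) :
      r = r' :=
    Ban.Hom.ext (ContinuousLinearMap.ext fun z => k.injective
      (congrArg (fun t : Z ⟶ k.tgt => t.clm z) e))
  have hepi {Z : Ban.{u} 𝕜} (r r' : g.tgt ⟶ Z) (e : a.bot ≫ r = a.bot ≫ r') : r = r' := by
    refine Ban.Hom.ext (ContinuousLinearMap.ext fun z => ?_)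
    obtain ⟨x, rfl⟩ := ha z
    exact congrArg (fun t : f.tgt ⟶ Z => t.clm x) e
  choose lift hl using hlift
  choose desc hd using hdesc
  refine ⟨⟨⟨a.comm⟩, ⟨Limits.PullbackCone.IsLimit.mk _ lift (fun s => hmono g _ _ ?_) hl
      fun s m _ hm => hmono f _ _ (hm.trans (hl s).symm)⟩⟩,
    ⟨Limits.PushoutCocone.IsColimit.mk _ desc (fun s => ?_) hd
      fun s m _ hm => hepi _ _ (hm.trans (hd s).symm)⟩⟩
  · rw [Category.assoc, a.comm, ← Category.assoc, hl, s.condition]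
  · refine Ban.Hom.ext (ContinuousLinearMap.ext fun y => ?_)
    obtain ⟨x, hx⟩ := ha (g.map.clm y)
    obtain ⟨x', rfl⟩ := h x y hx
    rw [← Hom.comm_apply] at hx
    obtain rfl : a.top.clm x' = y := g.injective hx
    have h1 : a.top ≫ g.map ≫ desc s = a.top ≫ s.inl := by
      rw [← Category.assoc, a.comm, Category.assoc, hd, s.condition]
    exact congrArg (fun t : f.src ⟶ s.pt => t.clm x') h1

/-- The objects whose target has the lifting property for surjective operators. -/
def HasProjectiveTarget (p : BanMono.{u} 𝕜) : Prop :=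
  ∀ (E F : Type u) [NormedAddCommGroup E] [NormedSpace 𝕜 E] [CompleteSpace E]
    [NormedAddCommGroup F] [NormedSpace 𝕜 F] [CompleteSpace F]
    (q : E →L[𝕜] F), Function.Surjective q → ∀ T : p.tgt →L[𝕜] F,
      ∃ S : p.tgt →L[𝕜] E, ∀ x, q (S x) = T x

/-- Every object admits a pulation from an object with projective target. -/
theorem exists_isPulation_hasProjectiveTarget (g : BanMono.{u} 𝕜) :
    ∃ (p : BanMono.{u} 𝕜) (s : p ⟶ g), p.HasProjectiveTarget ∧ IsPulation s := by
  obtain ⟨T, hT⟩ := EllOne.exists_surjective (𝕜 := 𝕜) g.tgt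
  let L : Ban.{u} 𝕜 := Ban.of (𝕜 := 𝕜) (EllOne 𝕜 g.tgt)
  let d : (g.src × EllOne 𝕜 g.tgt) →L[𝕜] g.tgt :=
    g.map.clm.comp (.fst 𝕜 _ _) - T.comp (.snd 𝕜 _ _)
  let K : Submodule 𝕜 (g.src × EllOne 𝕜 g.tgt) := d.ker
  have : CompleteSpace K := (ContinuousLinearMap.isClosed_ker d).completeSpace_coe
  have hK (k : K) : g.map.clm k.1.1 = T k.1.2 := sub_eq_zero.1 k.2
  let p : BanMono.{u} 𝕜 :=
    { src := Ban.of (𝕜 := 𝕜) K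
      tgt := L
      map := ⟨(ContinuousLinearMap.snd 𝕜 _ _).comp K.subtypeL⟩
      injective := by
        intro k l hkl
        have h2 : k.1.2 = l.1.2 := hkl
        refine Subtype.ext (Prod.ext (g.injective ?_) h2)
        exact (hK k).trans ((congrArg T h2).trans (hK l).symm) }
  let s : p ⟶ g :=
    { top := ⟨(ContinuousLinearMap.fst 𝕜 _ _).comp K.subtypeL⟩
      bot := ⟨T⟩
      comm := Ban.Hom.ext (ContinuousLinearMap.ext hK) }
  refine ⟨p, s, fun E F _ _ _ _ _ _ q hq S => EllOne.exists_lift q hq S,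
    isPulation_of_surjective s hT fun x y hxy => ⟨⟨(y, x), sub_eq_zero.2 hxy.symm⟩, rfl⟩⟩

/-- Lift `a.bot` through the surjective sum operator on `Y' × X`. The `X`-component is the required
morphism, by the pullback property, and the `Y'`-component accounts for the homotopy. -/
theorem HasProjectiveTarget.exists_lift {p f g : BanMono.{u} 𝕜} (hp : p.HasProjectiveTarget)
    {s : f ⟶ g} (hs : IsPulation s) (a : p ⟶ g) : ∃ b : p ⟶ f, homotopic 𝕜 (b ≫ s) a := by
  let d : (g.src × f.tgt) →L[𝕜] g.tgt :=
    g.map.clm.comp (.fst 𝕜 _ _) + s.bot.clm.comp (.snd 𝕜 _ _)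
  have hd : Function.Surjective d := fun y => by
    obtain ⟨x, y', h⟩ := hs.exists_add y
    exact ⟨(y', x), by simpa [d, add_comm] using h⟩
  obtain ⟨S, hS⟩ := hp _ _ d hd a.bot.clm
  replace hS (x : p.tgt) : g.map.clm (S x).1 + s.bot.clm (S x).2 = a.bot.clm x := hS x
  obtain ⟨b, hb⟩ := exists_hom_bot_eq p f ((ContinuousLinearMap.snd 𝕜 _ _).comp S) fun x =>
    hs.exists_src (y := a.top.clm x - (S (p.map.clm x)).1) (by
      rw [map_sub, Hom.comm_apply, ← hS, add_sub_cancel_left]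
      rfl)
  refine ⟨b, homotopic_of_forall_exists fun x => ⟨-(S x).1, ?_⟩⟩
  have : (b ≫ s).bot.clm x = s.bot.clm (S x).2 := by
    change s.bot.clm (b.bot.clm x) = _
    rw [hb]
    rfl
  rw [this, map_neg, ← hS]
  abel

/-! ### The vector space quotient -/

variable (𝕜) in
/-- The vector space quotient `X / X'` of an object `X' ↣ X`. -/
noncomputable def quotientFunctor : BanMono.{u} 𝕜 ⥤ ModuleCat.{u} 𝕜 where
  obj f := ModuleCat.of 𝕜 (f.tgt ⧸ f.map.clm.range)
  map {f g} a := ModuleCat.ofHom (Submodule.mapQ _ _ a.bot.clm.toLinearMap (by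
    rintro _ ⟨x, rfl⟩
    exact ⟨a.top.clm x, Hom.comm_apply a x⟩))
  map_id f := by
    ext x
    rfl
  map_comp a b := by
    ext x
    rfl

/-- The class of an element in the quotient. -/
noncomputable def quotientMk (f : BanMono.{u} 𝕜) (x : f.tgt) : (quotientFunctor 𝕜).obj f :=
  Submodule.Quotient.mk (p := f.map.clm.range) x

theorem quotientMk_surjective (f : BanMono.{u} 𝕜) : Function.Surjective f.quotientMk :=
  Submodule.Quotient.mk_surjective _

theorem quotientMk_eq_iff {f : BanMono.{u} 𝕜} {x y : f.tgt} :
    f.quotientMk x = f.quotientMk y ↔ ∃ z : f.src, f.map.clm z = x - y :=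
  Submodule.Quotient.eq _

theorem quotientMk_zero (f : BanMono.{u} 𝕜) : f.quotientMk 0 = 0 := rfl

theorem quotientFunctor_map_quotientMk {f g : BanMono.{u} 𝕜} (a : f ⟶ g) (x : f.tgt) :
    (quotientFunctor 𝕜).map a (f.quotientMk x) = g.quotientMk (a.bot.clm x) := rfl

theorem quotientFunctor_map_eq_iff {f g : BanMono.{u} 𝕜} {a b : f ⟶ g} :
    (quotientFunctor 𝕜).map a = (quotientFunctor 𝕜).map b ↔ homotopic 𝕜 a b := by
  refine ⟨fun h => homotopic_of_forall_exists fun x => quotientMk_eq_iff.1 ?_, fun ⟨r, hr⟩ => ?_⟩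
  · rw [← quotientFunctor_map_quotientMk, h, quotientFunctor_map_quotientMk]
  · ext x
    obtain ⟨x, rfl⟩ := f.quotientMk_surjective x
    exact quotientMk_eq_iff.2 ⟨r.clm x, (hr x).symm⟩

theorem IsPulation.isIso_map {f g : BanMono.{u} 𝕜} {a : f ⟶ g} (ha : IsPulation a) :
    IsIso ((quotientFunctor 𝕜).map a) := by
  rw [ConcreteCategory.isIso_iff_bijective]
  constructor
  · rw [injective_iff_map_eq_zero]
    intro x hx
    obtain ⟨x, rfl⟩ := f.quotientMk_surjective x
    rw [quotientFunctor_map_quotientMk, ← quotientMk_zero, quotientMk_eq_iff] at hx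
    obtain ⟨y, hy⟩ := hx
    rw [sub_zero] at hy
    obtain ⟨x', hx'⟩ := ha.exists_src hy.symm
    exact quotientMk_eq_iff.2 ⟨x', by rw [hx', sub_zero]⟩
  · intro y
    obtain ⟨y, rfl⟩ := g.quotientMk_surjective y
    obtain ⟨x, y', h⟩ := ha.exists_add y
    refine ⟨f.quotientMk x, quotientMk_eq_iff.2 ⟨-y', ?_⟩⟩
    rw [map_neg, ← h]
    exact (sub_add_cancel_left _ _).symm

end BanMono

/-! ### Morphisms of **W** and the faithful functor to vector spaces -/

namespace WCat

open BanMono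

variable {𝕜 : Type} [RCLike 𝕜]

variable (𝕜) in
/-- The functor from **M** to **W**. -/
noncomputable abbrev ofBanMono : BanMono.{u} 𝕜 ⥤ WCat.{u} 𝕜 :=
  CategoryTheory.Quotient.functor (homotopic 𝕜) ⋙ (pulations 𝕜).Q

theorem exists_obj_eq (A : WCat.{u} 𝕜) : ∃ f : BanMono.{u} 𝕜, A = (ofBanMono 𝕜).obj f :=
  ⟨((Localization.Construction.objEquiv (pulations.{u} 𝕜)).symm A).as,
    ((Localization.Construction.objEquiv (pulations.{u} 𝕜)).apply_symm_apply A).symm⟩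

theorem map_eq_of_homotopic {f g : BanMono.{u} 𝕜} {a b : f ⟶ g} (h : homotopic 𝕜 a b) :
    (ofBanMono 𝕜).map a = (ofBanMono 𝕜).map b :=
  congrArg (pulations 𝕜).Q.map (CategoryTheory.Quotient.sound _ h)

theorem isIso_map {f g : BanMono.{u} 𝕜} {a : f ⟶ g} (h : IsPulation a) :
    IsIso ((ofBanMono 𝕜).map a) :=
  (pulations 𝕜).Q_inverts _ ⟨a, h, rfl⟩

variable (𝕜) in
/-- The vector space quotient on **hM**. -/
noncomputable def hQuotientFunctor : HBanMono.{u} 𝕜 ⥤ ModuleCat.{u} 𝕜 :=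
  CategoryTheory.Quotient.lift _ (quotientFunctor 𝕜) fun _ _ _ _ h =>
    quotientFunctor_map_eq_iff.2 h

theorem pulations_isInvertedBy : (pulations.{u} 𝕜).IsInvertedBy (hQuotientFunctor 𝕜) := by
  rintro f g _ ⟨a, ha, rfl⟩
  exact ha.isIso_map

variable (𝕜) in
/-- The vector space quotient on **W**. -/
noncomputable def toModuleCat : WCat.{u} 𝕜 ⥤ ModuleCat.{u} 𝕜 :=
  Localization.Construction.lift (hQuotientFunctor 𝕜) pulations_isInvertedBy

/-- The class of an element in the quotient of an object of **W**. -/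
noncomputable def cls (f : BanMono.{u} 𝕜) (x : f.tgt) : (toModuleCat 𝕜).obj ((ofBanMono 𝕜).obj f) :=
  f.quotientMk x

theorem cls_surjective (f : BanMono.{u} 𝕜) : Function.Surjective (cls f) :=
  f.quotientMk_surjective

theorem cls_eq_iff {f : BanMono.{u} 𝕜} {x y : f.tgt} :
    cls f x = cls f y ↔ ∃ z : f.src, f.map.clm z = x - y :=
  quotientMk_eq_iff

theorem cls_eq_zero_iff {f : BanMono.{u} 𝕜} {x : f.tgt} :
    cls f x = 0 ↔ ∃ z : f.src, f.map.clm z = x := by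
  have h := cls_eq_iff (f := f) (x := x) (y := 0)
  rwa [sub_zero] at h

theorem toModuleCat_map_cls {f g : BanMono.{u} 𝕜} (a : f ⟶ g) (x : f.tgt) :
    (toModuleCat 𝕜).map ((ofBanMono 𝕜).map a) (cls f x) = cls g (a.bot.clm x) := by
  have h := Functor.congr_hom
    (Localization.Construction.fac (hQuotientFunctor.{u} 𝕜) pulations_isInvertedBy)
    ((CategoryTheory.Quotient.functor (homotopic 𝕜)).map a)
  replace h := h.trans ((Category.id_comp _).trans (Category.comp_id _))
  exact congrArg (fun k => k (f.quotientMk x)) h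

theorem homotopic_of_toModuleCat_map_eq {f g : BanMono.{u} 𝕜} {a b : f ⟶ g}
    (h : (toModuleCat 𝕜).map ((ofBanMono 𝕜).map a) = (toModuleCat 𝕜).map ((ofBanMono 𝕜).map b)) :
    homotopic 𝕜 a b :=
  homotopic_of_forall_exists fun x => cls_eq_iff.1 (by
    rw [← toModuleCat_map_cls, h, toModuleCat_map_cls])

/-- Morphisms of **W** out of an object with projective target come from **M**. -/
theorem exists_map_eq {p g : BanMono.{u} 𝕜} (hp : p.HasProjectiveTarget)
    (φ : (ofBanMono 𝕜).obj p ⟶ (ofBanMono 𝕜).obj g) :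
    ∃ a : p ⟶ g, (ofBanMono 𝕜).map a = φ := by
  have hinj {f g : BanMono.{u} 𝕜} (h : (ofBanMono 𝕜).obj f = (ofBanMono 𝕜).obj g) : f = g :=
    congrArg CategoryTheory.Quotient.as
      ((Localization.Construction.objEquiv (pulations.{u} 𝕜)).injective h)
  let R {A : WCat.{u} 𝕜} (β : (ofBanMono 𝕜).obj p ⟶ A) : Prop :=
    -- Composites with generators of **W** are followed one at a time: squares compose, and inverses
    -- of pulations are handled by lifting.
    ∃ (f : BanMono.{u} 𝕜) (e : (ofBanMono 𝕜).obj f = A) (a : p ⟶ f),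
      β = (ofBanMono 𝕜).map a ≫ eqToHom e
  let P : MorphismProperty (WCat.{u} 𝕜) := fun A B φ =>
    ∀ β : (ofBanMono 𝕜).obj p ⟶ A, R β → R (β ≫ φ)
  have : P.IsStableUnderComposition := ⟨fun φ ψ hφ hψ β hβ => by
    rw [← Category.assoc]
    exact hψ _ (hφ _ hβ)⟩
  have htop : P = ⊤ := by
    apply Localization.Construction.morphismProperty_eq_top
    · rintro ⟨X⟩ ⟨Y⟩ φ β ⟨f, e, a, rfl⟩
      obtain rfl : f = X := hinj e
      obtain ⟨b, rfl⟩ := (CategoryTheory.Quotient.functor (homotopic 𝕜)).map_surjective φ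
      refine ⟨Y, rfl, a ≫ b, ?_⟩
      rw [Functor.map_comp, eqToHom_refl, eqToHom_refl, Category.comp_id, Category.comp_id]
      rfl
    · rintro ⟨X⟩ ⟨Y⟩ _ ⟨s, hs, rfl⟩ β ⟨f, e, a, rfl⟩
      obtain rfl : f = Y := hinj e
      obtain ⟨b, hb⟩ := hp.exists_lift hs a
      refine ⟨X, rfl, b, ?_⟩
      rw [eqToHom_refl, eqToHom_refl, Category.comp_id, Category.comp_id,
        ← map_eq_of_homotopic hb, Functor.map_comp, Category.assoc]
      exact (congrArg (_ ≫ ·)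
        (Localization.Construction.wIso _ ⟨s, hs, rfl⟩).hom_inv_id).trans (Category.comp_id _)
  have hφ : P φ := htop ▸ trivial
  obtain ⟨f, e, a, h⟩ := hφ (𝟙 _) ⟨p, rfl, 𝟙 p, by simp⟩
  obtain rfl : f = g := hinj e
  exact ⟨a, by simpa using h.symm⟩

/-- Precomposing with a pulation from a projective target reduces to two squares of **M**; these are
homotopic as soon as they agree on the quotients. -/
instance : (toModuleCat.{u} 𝕜).Faithful where
  map_injective {A B} φ ψ h := by
    obtain ⟨f, rfl⟩ := exists_obj_eq A
    obtain ⟨g, rfl⟩ := exists_obj_eq B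
    obtain ⟨p, s, hp, hs⟩ := exists_isPulation_hasProjectiveTarget f
    have := isIso_map hs
    rw [← cancel_epi ((ofBanMono 𝕜).map s)]
    obtain ⟨a, ha⟩ := exists_map_eq hp ((ofBanMono 𝕜).map s ≫ φ)
    obtain ⟨b, hb⟩ := exists_map_eq hp ((ofBanMono 𝕜).map s ≫ ψ)
    rw [← ha, ← hb]
    refine map_eq_of_homotopic (homotopic_of_toModuleCat_map_eq ?_)
    rw [ha, hb, Functor.map_comp, Functor.map_comp, h]

theorem isZero_of_surjective {f : BanMono.{u} 𝕜} (hf : Function.Surjective f.map.clm) :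
    Limits.IsZero ((ofBanMono 𝕜).obj f) := by
  have hV : Limits.IsZero ((toModuleCat 𝕜).obj ((ofBanMono 𝕜).obj f)) := by
    rw [ModuleCat.isZero_iff_subsingleton, subsingleton_iff_forall_eq 0]
    intro x
    obtain ⟨x, rfl⟩ := cls_surjective f x
    exact cls_eq_zero_iff.2 (hf x)
  constructor
  · intro B
    obtain ⟨g, rfl⟩ := exists_obj_eq B
    refine ⟨⟨⟨(ofBanMono 𝕜).map ⟨⟨0⟩, ⟨0⟩, ?_⟩⟩, fun φ =>
      (toModuleCat 𝕜).map_injective (hV.eq_of_src _ _)⟩⟩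
    exact Ban.Hom.ext (ContinuousLinearMap.ext fun x => map_zero g.map.clm)
  · intro B
    obtain ⟨g, rfl⟩ := exists_obj_eq B
    refine ⟨⟨⟨(ofBanMono 𝕜).map ⟨⟨0⟩, ⟨0⟩, ?_⟩⟩, fun φ =>
      (toModuleCat 𝕜).map_injective (hV.eq_of_tgt _ _)⟩⟩
    exact Ban.Hom.ext (ContinuousLinearMap.ext fun x => map_zero f.map.clm)

theorem mono_map {f g : BanMono.{u} 𝕜} (a : f ⟶ g)
    (h : ∀ (x : f.tgt) (y : g.src), g.map.clm y = a.bot.clm x → ∃ x' : f.src, f.map.clm x' = x) :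
    Mono ((ofBanMono 𝕜).map a) := by
  apply (toModuleCat 𝕜).mono_of_mono_map
  rw [ModuleCat.mono_iff_injective, injective_iff_map_eq_zero]
  intro x hx
  obtain ⟨x, rfl⟩ := cls_surjective f x
  rw [toModuleCat_map_cls, cls_eq_zero_iff] at hx
  obtain ⟨y, hy⟩ := hx
  exact cls_eq_zero_iff.2 (h x y hy)

/-! ### A monomorphism without retraction -/

/-- A retraction of `a : f ⟶ g` turns any `d : p ⟶ g` with `p` projective into a morphism
`t : p ⟶ f` of **M** such that `t` maps `y` to the class of `x` whenever `d y` and `a x` have the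
same class. -/
theorem exists_hom_of_isSplitMono {f g p : BanMono.{u} 𝕜} (hp : p.HasProjectiveTarget)
    (a : f ⟶ g) (ha : IsSplitMono ((ofBanMono 𝕜).map a)) (d : p ⟶ g) :
    ∃ t : p ⟶ f, ∀ (x : f.tgt) (y : p.tgt), cls g (d.bot.clm y) = cls g (a.bot.clm x) →
      cls f (t.bot.clm y) = cls f x := by
  obtain ⟨⟨ρ, hρ⟩⟩ := ha
  obtain ⟨t, ht⟩ := exists_map_eq hp ((ofBanMono 𝕜).map d ≫ ρ)
  refine ⟨t, fun x y h => ?_⟩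
  rw [← toModuleCat_map_cls, ht, Functor.map_comp, ModuleCat.comp_apply, toModuleCat_map_cls, h,
    ← toModuleCat_map_cls, ← ModuleCat.comp_apply, ← Functor.map_comp, hρ, CategoryTheory.Functor.map_id,
    ModuleCat.id_apply]

theorem exists_mono_not_isSplitMono {f : BanMono.{u} 𝕜} (hf : ¬ Function.Surjective f.map.clm) :
    ∃ (g : BanMono.{u} 𝕜) (a : f ⟶ g),
      Mono ((ofBanMono 𝕜).map a) ∧ ¬ IsSplitMono ((ofBanMono 𝕜).map a) := by
  obtain ⟨x, c, hc0, hc1, hcs, hne⟩ := f.map.clm.exists_weights_apply_ne.{u} hf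
  let I := ULift.{u} ℕ
  let L : Ban.{u} 𝕜 := Ban.of (𝕜 := 𝕜) (EllOne 𝕜 I)
  have hcb (i : I) : ‖(c i.down : 𝕜)‖ ≤ 1 := by
    simpa [abs_of_pos (hc0 i.down)] using hc1 i.down
  have hc0' (i : I) : (c i.down : 𝕜) ≠ 0 := by exact_mod_cast (hc0 _).ne'
  let y₀ : EllOne 𝕜 I := ⟨fun i => c i.down, memℓp_gen (by
    have := Equiv.ulift.{u}.summable_iff.2 hcs
    simpa [Function.comp_def, abs_of_pos (hc0 _)] using this)⟩
  have hy₀ (i : I) : y₀ i = c i.down := rfl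
  obtain ⟨D, hD⟩ := EllOne.exists_extend_single (𝕜 := 𝕜)
    (fun i : I => (c i.down : 𝕜) • EllOne.unit 𝕜 i) (C := 1) fun i => by
      rw [norm_smul, EllOne.norm_unit, mul_one]
      exact hcb i
  have hDapply (a : EllOne 𝕜 I) (i : I) : D a i = c i.down * a i := by
    have h := EllOne.ext_single (S := (lp.evalCLM 𝕜 (fun _ : I => 𝕜) 1 i).comp D)
      (T := (c i.down : 𝕜) • lp.evalCLM 𝕜 (fun _ : I => 𝕜) 1 i) fun j => by
        change D (EllOne.unit 𝕜 j) i = c i.down * EllOne.unit 𝕜 j i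
        rw [hD]
        change (c j.down : 𝕜) * EllOne.unit 𝕜 j i = _
        rcases eq_or_ne i j with rfl | hij
        · rfl
        · rw [EllOne.unit_apply_of_ne hij, mul_zero, mul_zero]
    exact congrArg (fun k => k a) h
  -- Cancelling the weights, `D a = t • y₀` forces `a` to be the constant family `t`, which is
  -- summable only for `t = 0`. This gives the injectivity of `D` and `G` and the monomorphism.
  have hker (a : EllOne 𝕜 I) (t : 𝕜) (h : D a - t • y₀ = 0) : t = 0 ∧ a = 0 := by
    have hat (i : I) : a i = t := by
      refine mul_left_cancel₀ (hc0' i) ?_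
      rw [← hDapply, sub_eq_zero.1 h, mul_comm]
      rfl
    have ht : t = 0 := by
      have hs := EllOne.summable_norm a
      simp only [hat] at hs
      exact norm_eq_zero.1 ((summable_const_iff _).1 hs)
    exact ⟨ht, lp.ext (funext fun i => (hat i).trans ht)⟩
  have hDinj : Function.Injective D := by
    rw [injective_iff_map_eq_zero]
    exact fun a ha => (hker a 0 (by rw [ha, zero_smul, sub_zero])).2
  let p : BanMono.{u} 𝕜 := ⟨L, L, ⟨D⟩, hDinj⟩
  have hp : p.HasProjectiveTarget := fun E F _ _ _ _ _ _ q hq S => EllOne.exists_lift q hq S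
  -- The relations of the glued object: the ranges of `f` and `D`, and the line through `(x, -y₀)`.
  let G : (f.src × EllOne 𝕜 I × 𝕜) →L[𝕜] (f.tgt × EllOne 𝕜 I) :=
    (f.map.clm.coprod ((ContinuousLinearMap.snd 𝕜 _ _).smulRight x)).prod
      ((D.coprod (-(ContinuousLinearMap.id 𝕜 𝕜).smulRight y₀)).comp (.snd 𝕜 _ _))
  have hG (w) : G w = (f.map.clm w.1 + w.2.2 • x, D w.2.1 - w.2.2 • y₀) := by
    simp [G, sub_eq_add_neg]
  have hGker (w) (h : D w.2.1 - w.2.2 • y₀ = 0) : w = (w.1, 0) ∧ G w = (f.map.clm w.1, 0) := by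
    obtain ⟨h1, h2⟩ := hker _ _ h
    exact ⟨Prod.ext rfl (Prod.ext h2 h1), by rw [hG, h, h1, zero_smul, add_zero]⟩
  have hGinj : Function.Injective G := by
    rw [injective_iff_map_eq_zero]
    intro w hw
    obtain ⟨h1, h2⟩ := hGker w (by rw [hG] at hw; exact congrArg Prod.snd hw)
    rw [hw] at h2
    have h3 : w.1 = 0 := f.injective ((congrArg Prod.fst h2).symm.trans (map_zero f.map.clm).symm)
    rw [h1, h3]
    rfl
  let g : BanMono.{u} 𝕜 :=
    ⟨Ban.of (𝕜 := 𝕜) (f.src × EllOne 𝕜 I × 𝕜), Ban.of (𝕜 := 𝕜) (f.tgt × EllOne 𝕜 I), ⟨G⟩, hGinj⟩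
  obtain ⟨a, ha⟩ := exists_hom_bot_eq f g (.inl 𝕜 _ _) fun z =>
    ⟨(z, 0), (hG _).trans
      (show (f.map.clm z + (0 : 𝕜) • x, D 0 - (0 : 𝕜) • y₀) = (f.map.clm z, 0) by simp)⟩
  obtain ⟨d, hd⟩ := exists_hom_bot_eq p g (.inr 𝕜 _ _) fun z =>
    ⟨(0, z, 0), (hG _).trans
      (show (f.map.clm 0 + (0 : 𝕜) • x, D z - (0 : 𝕜) • y₀) = (0, D z) by simp)⟩
  refine ⟨g, a, mono_map a fun z w hw => ⟨w.1, ?_⟩, fun hs => ?_⟩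
  · rw [ha] at hw
    change G w = (z, 0) at hw
    have h := (hGker w (by rw [hG] at hw; exact congrArg Prod.snd hw)).2
    exact congrArg Prod.fst (h.symm.trans hw)
  · obtain ⟨t, ht⟩ := exists_hom_of_isSplitMono hp a hs d
    -- The coefficient `-1` on the gluing relation gives `(-x, y₀)`, so `x` and `y₀` have the same
    -- class in `g`.
    obtain ⟨z, hz⟩ := cls_eq_iff.1 (ht x y₀ (cls_eq_iff.2 ⟨(0, 0, -1), by
      rw [ha, hd]
      exact (hG _).trans (show (f.map.clm 0 + (-1 : 𝕜) • x, D 0 - (-1 : 𝕜) • y₀)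
        = ((0, y₀) - (x, 0) : f.tgt × EllOne 𝕜 I) by simp)⟩))
    refine hne t.bot.clm t.top.clm (fun i => ?_) y₀ hy₀ z (by rw [hz]; abel)
    rw [Hom.comm_apply, ← map_smul, ← hD]

end WCat

theorem mainTheorem3 (𝕜 : Type) [RCLike 𝕜] (A : WCat.{u} 𝕜) :
    (Injective A ↔ Limits.IsZero A) ∧
      (¬ Limits.IsZero A → ∃ (B : WCat.{u} 𝕜) (m : A ⟶ B), Mono m ∧ ¬ IsSplitMono m) := by
  have key : ¬ Limits.IsZero A → ∃ (B : WCat.{u} 𝕜) (m : A ⟶ B), Mono m ∧ ¬ IsSplitMono m := by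
    intro hA
    obtain ⟨f, rfl⟩ := WCat.exists_obj_eq A
    obtain ⟨g, a, ha⟩ := WCat.exists_mono_not_isSplitMono
      fun hf => hA (WCat.isZero_of_surjective hf)
    exact ⟨_, _, ha⟩
  refine ⟨⟨fun hA => ?_, fun hA => hA.injective⟩, key⟩
  by_contra h
  obtain ⟨B, m, hm, hs⟩ := key h
  exact hs ⟨⟨⟨Injective.factorThru (𝟙 A) m, Injective.comp_factorThru _ _⟩⟩⟩
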